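/- We consider first-order, (parametrically polymorphically) typed constructor-based programs. A signature consists of data types, of constructors $c$ of given arities (each belonging to a data type $T\,\alpha_1\dots\alpha_k$, with argument types mentioning only $\alpha_1,\dots,\alpha_k$), and of operations $f$ of given arities with declared, possibly polymorphic, types $\tau_1\to\dots\to\tau_n\to\tau$. An \emph{expression} is a well-typed term without variables and without $\bot$ in which every constructor and operation is applied to as many arguments as its arity; a \emph{value} is an expression in which no operation occurs. A \emph{program} $P$ over the signature is a set of rules $f\,t_1\dots t_n = r$ which are well-typed with respect to the declared type of $f$, where $t_1,\dots,t_n$ are built from constructors and variables only and every variable of $r$ occurs in some $t_i$. The reduction relation $\to$ is given by the single rule $$\mathcal C[f\,\sigma(t_1)\dots\sigma(t_n)]\ \to\ \mathcal C[\sigma(r)],$$ where $\mathcal C$ is a context, $f\,t_1\dots t_n = r$ is a rule of $P$, and $\sigma$ substitutes values for the variables of the rule; here $f\,\sigma(t_1)\dots\sigma(t_n)$ is called a redex rooted by $f$ and $\sigma(r)$ a reduct of it. Let $\to^*$ be the reflexive-transitive closure of $\to$. An operation $f$ of type $\tau_1\to\dots\to\tau_n\to\tau$ is \emph{totally defined}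 if, for every instance of its type and all values $v_1,\dots,v_n$ of the (instantiated) argument types, $f\,v_1\dots v_n\to^* v$ for some value $v$ of the (instantiated) result type. It is \emph{deterministically defined} if every redex rooted by $f$ has only one reduct. \textbf{Lemma.} Let $P$ be a program in which every operation of the signature is both totally and deterministically defined. Then, for every expression $e$ over the signature of $P$: (1) there exists a unique value $v$ such that $e\to^* v$, and (2) there is no infinite computation $e=e_0\to e_1\to e_2\to\cdots$ of $e$. -/

import Mathlib

namespace FLP

/-- First-order type expressions over the type constructors `D` (with arities `ar`) and
type variables `V`. -/
inductive Ty {D : Type*} (ar : D → ℕ) (V : Type*) where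
  | var : V → Ty ar V
  | data : (d : D) → (Fin (ar d) → Ty ar V) → Ty ar V

/-- Instantiation of the type variables. -/
def Ty.subst {D : Type*} {ar : D → ℕ} {V W : Type*} (θ : V → Ty ar W) : Ty ar V → Ty ar W
  | .var a => θ a
  | .data d ts => .data d (fun i => (ts i).subst θ)

/-- The signature of a program. A constructor `c` comes from the declaration of a (possibly
polymorphic) data type `conData c`; its argument types may mention only the type parameters of
that data type, and its result type is the data type applied to its parameters.
An operation has a (possibly polymorphic) type `opArg f 0 → ⋯ → opArg f (n-1) → opRes f`. -/
structure Signature where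
  Data : Type*
  dataArity : Data → ℕ
  Con : Type*
  conArity : Con → ℕ
  conData : Con → Data
  conArg : (c : Con) → Fin (conArity c) → Ty dataArity (Fin (dataArity (conData c)))
  Op : Type*
  opArity : Op → ℕ
  opArg : (f : Op) → Fin (opArity f) → Ty dataArity ℕ
  opRes : Op → Ty dataArity ℕ

/-- The types of a signature, with type variables named by natural numbers. -/
abbrev Signature.Typ (S : Signature) := Ty S.dataArity ℕ

/-- Expressions with variables in `V`: variables, and constructors or operations applied to
as many arguments as their arity says. The symbol `⊥` is not part of the language. -/
inductive Expr (S : Signature) (V : Type*) where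
  | var : V → Expr S V
  | con : (c : S.Con) → (Fin (S.conArity c) → Expr S V) → Expr S V
  | op : (f : S.Op) → (Fin (S.opArity f) → Expr S V) → Expr S V

/-- Expressions without variables. -/
abbrev Closed (S : Signature) := Expr S Empty

namespace Expr

variable {S : Signature} {V W : Type*}

def subst (σ : V → Expr S W) : Expr S V → Expr S W
  | var x => σ x
  | con c es => con c (fun i => (es i).subst σ)
  | op f es => op f (fun i => (es i).subst σ)

/-- The variable `x` occurs in the expression. -/
def Occurs (x : V) : Expr S V → Prop
  | var y => y = x
  | con _ es => ∃ i, (es i).Occurs x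
  | op _ es => ∃ i, (es i).Occurs x

/-- No operation occurs in the expression: it is built from constructors and variables. -/
def OpFree : Expr S V → Prop
  | var _ => True
  | con _ es => ∀ i, (es i).OpFree
  | op _ _ => False

/-- A value is an expression without operations and without variables. -/
def IsValue (e : Closed S) : Prop := e.OpFree

/-- `HasType Γ e τ`: under the typing `Γ` of its variables, `e` has type `τ`. Each occurrence of a
symbol is used at an instance `θ` of its declared type. -/
inductive HasType (Γ : V → S.Typ) : Expr S V → S.Typ → Prop
  | var (x : V) : HasType Γ (var x) (Γ x)
  | con (c : S.Con) (θ : Fin (S.dataArity (S.conData c)) → S.Typ)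
      (es : Fin (S.conArity c) → Expr S V)
      (h : ∀ i, HasType Γ (es i) ((S.conArg c i).subst θ)) :
      HasType Γ (con c es) (.data (S.conData c) θ)
  | op (f : S.Op) (θ : ℕ → S.Typ) (es : Fin (S.opArity f) → Expr S V)
      (h : ∀ i, HasType Γ (es i) ((S.opArg f i).subst θ)) :
      HasType Γ (op f es) ((S.opRes f).subst θ)

end Expr

/-- The closed expression `e` has type `τ`. -/
def Closed.HasType {S : Signature} (e : Closed S) (τ : S.Typ) : Prop :=
  Expr.HasType (fun x : Empty => x.elim) e τ

/-- The closed expression `e` is well-typed. -/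
def Closed.WellTyped {S : Signature} (e : Closed S) : Prop := ∃ τ, Closed.HasType e τ

/-- A program rule `f t₁ … tₙ = r`. It follows the constructor discipline, has no free (extra)
variables in its right-hand side, and respects the declared type of `f`. -/
structure Rule (S : Signature) where
  root : S.Op
  pat : Fin (S.opArity root) → Expr S ℕ
  rhs : Expr S ℕ
  pat_opFree : ∀ i, (pat i).OpFree
  rhs_vars : ∀ x, rhs.Occurs x → ∃ i, (pat i).Occurs x
  typed : ∃ Γ : ℕ → S.Typ,
    (∀ i, Expr.HasType Γ (pat i) (S.opArg root i)) ∧ Expr.HasType Γ rhs (S.opRes root)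

/-- A program over the signature `S` is a set of rules. -/
abbrev Program (S : Signature) := Set (Rule S)

namespace Program

variable {S : Signature} (P : Program S)

/-- `e` is a redex with reduct `e'`: an instance of a rule under a substitution of values for the
variables of the rule (call-time choice). -/
inductive Contracts : Closed S → Closed S → Prop
  | rule (ρ : Rule S) (hρ : ρ ∈ P) (σ : ℕ → Closed S)
      (hσ : ∀ x, (∃ i, (ρ.pat i).Occurs x) → (σ x).IsValue) :
      Contracts (.op ρ.root (fun i => (ρ.pat i).subst σ)) (ρ.rhs.subst σ)

/-- The reduction relation: contraction of a redex in an arbitrary context. -/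
inductive Step : Closed S → Closed S → Prop
  | root {e e' : Closed S} (h : P.Contracts e e') : Step e e'
  | con (c : S.Con) (es : Fin (S.conArity c) → Closed S) (i : Fin (S.conArity c)) {e' : Closed S}
      (h : Step (es i) e') : Step (.con c es) (.con c (Function.update es i e'))
  | op (f : S.Op) (es : Fin (S.opArity f) → Closed S) (i : Fin (S.opArity f)) {e' : Closed S}
      (h : Step (es i) e') : Step (.op f es) (.op f (Function.update es i e'))

/-- The reflexive and transitive closure of the reduction relation. -/
def Reduces : Closed S → Closed S → Prop := Relation.ReflTransGen P.Step

/-- `f` is totally defined: applied to values of its argument types (at any instance `θ` of its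
type) it evaluates to a value of its result type. -/
def TotallyDefined (f : S.Op) : Prop :=
  ∀ (θ : ℕ → S.Typ) (vs : Fin (S.opArity f) → Closed S),
    (∀ i, (vs i).IsValue ∧ Closed.HasType (vs i) ((S.opArg f i).subst θ)) →
    ∃ v : Closed S, v.IsValue ∧ Closed.HasType v ((S.opRes f).subst θ) ∧ P.Reduces (.op f vs) v

/-- `f` is deterministically defined: a (well-typed) redex rooted by `f` has only one reduct. -/
def DeterministicallyDefined (f : S.Op) : Prop :=
  ∀ (es : Fin (S.opArity f) → Closed S) (e₁ e₂ : Closed S), Closed.WellTyped (.op f es) →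
    P.Contracts (.op f es) e₁ → P.Contracts (.op f es) e₂ → e₁ = e₂

/-- `s` is an infinite computation of `e`. -/
def IsInfiniteComputation (e : Closed S) (s : ℕ → Closed S) : Prop :=
  s 0 = e ∧ ∀ n, P.Step (s n) (s (n + 1))

end Program

end FLP

namespace FLP

/-! Rule variables stand for values, so the arguments of a redex are values, and values are normal
forms. Redexes therefore never nest, and determinism gives a one-step diamond (`Step.diamond`): two
different reducts of a well-typed expression meet after one further step each. Consequently, a
single reduction to a value forces every reduction to end, and in that same value
(`Reduces.value_unique`, `Reduces.acc`). Such a reduction exists by innermost evaluation, using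
totality at each operation (`exists_value`). Both hypotheses speak of well-typed expressions only,
hence the need for subject reduction. -/

theorem Ty.subst_subst {D : Type*} {ar : D → ℕ} {U V W : Type*} (θ : U → Ty ar V)
    (η : V → Ty ar W) (τ : Ty ar U) :
    (τ.subst θ).subst η = τ.subst (fun a => (θ a).subst η) := by
  induction τ with
  | var a => rfl
  | data d ts ih => simp only [Ty.subst, ih]

namespace Expr

variable {S : Signature} {V : Type*}

theorem HasType.con_inv {Γ : V → S.Typ} {c : S.Con} {es : Fin (S.conArity c) → Expr S V}
    {τ : S.Typ} (h : HasType Γ (Expr.con c es) τ) :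
    ∃ θ, τ = .data (S.conData c) θ ∧ ∀ i, HasType Γ (es i) ((S.conArg c i).subst θ) := by
  cases h with
  | con _ θ _ h => exact ⟨θ, rfl, h⟩

theorem HasType.op_inv {Γ : V → S.Typ} {f : S.Op} {es : Fin (S.opArity f) → Expr S V}
    {τ : S.Typ} (h : HasType Γ (Expr.op f es) τ) :
    ∃ θ, τ = (S.opRes f).subst θ ∧ ∀ i, HasType Γ (es i) ((S.opArg f i).subst θ) := by
  cases h with
  | op _ θ _ h => exact ⟨θ, rfl, h⟩

theorem OpFree.subst {p : Expr S V} {σ : V → Closed S} (hp : p.OpFree)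
    (hσ : ∀ x, p.Occurs x → (σ x).IsValue) : (p.subst σ).IsValue := by
  induction p with
  | var x => exact hσ x rfl
  | con c ps ih => exact fun i => ih i (hp i) fun x hx => hσ x ⟨i, hx⟩
  | op f ps => exact hp.elim

/-- If an instance of a pattern has an instance of the type of the pattern, then the variables
of the pattern are substituted by expressions of the respective instances of their types. -/
theorem HasType.of_subst_pattern {Γ : V → S.Typ} {p : Expr S V} {τ : S.Typ}
    (h : HasType Γ p τ) (hp : p.OpFree) {σ : V → Closed S} {θ : ℕ → S.Typ}
    (hσ : Closed.HasType (p.subst σ) (τ.subst θ)) {x : V} (hx : p.Occurs x) :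
    Closed.HasType (σ x) ((Γ x).subst θ) := by
  induction h with
  | var y => cases hx; exact hσ
  | con c η ps h ih =>
    obtain ⟨i, hx⟩ := hx
    obtain ⟨ζ, hζ, hargs⟩ := HasType.con_inv hσ
    -- The result type of a constructor displays all its type parameters, so it determines the
    -- instance at which the constructor is used. Result types of operations need not do so.
    simp only [Ty.subst, Ty.data.injEq, heq_eq_eq, true_and] at hζ
    subst hζ
    refine ih i (hp i) ?_ hx
    rw [Ty.subst_subst]
    exact hargs i
  | op f η ps => exact hp.elim

theorem HasType.subst {Γ : V → S.Typ} {e : Expr S V} {τ : S.Typ} (h : HasType Γ e τ)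
    {σ : V → Closed S} {θ : ℕ → S.Typ}
    (hσ : ∀ x, e.Occurs x → Closed.HasType (σ x) ((Γ x).subst θ)) :
    Closed.HasType (e.subst σ) (τ.subst θ) := by
  induction h with
  | var x => exact hσ x rfl
  | con c η es h ih =>
    refine HasType.con c _ _ fun i => ?_
    rw [← Ty.subst_subst]
    exact ih i fun x hx => hσ x ⟨i, hx⟩
  | op f η es h ih =>
    rw [Ty.subst_subst]
    refine HasType.op f _ _ fun i => ?_
    rw [← Ty.subst_subst]
    exact ih i fun x hx => hσ x ⟨i, hx⟩

end Expr

namespace Program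

variable {S : Signature} {P : Program S}

theorem Contracts.isValue_arg {f : S.Op} {es : Fin (S.opArity f) → Closed S} {e : Closed S}
    (h : P.Contracts (.op f es) e) (i : Fin (S.opArity f)) : (es i).IsValue := by
  cases h with
  | rule ρ hρ σ hσ => exact (ρ.pat_opFree i).subst fun x hx => hσ x ⟨i, hx⟩

theorem not_contracts_con {c : S.Con} {es : Fin (S.conArity c) → Closed S} {e : Closed S} :
    ¬ P.Contracts (.con c es) e := by
  intro h
  cases h

/-- Matching the patterns against the typed arguments types the substitution; this covers the
right-hand side because it has no extra variables. -/
theorem Contracts.hasType {e e' : Closed S} (h : P.Contracts e e') {τ : S.Typ}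
    (he : Closed.HasType e τ) : Closed.HasType e' τ := by
  cases h with
  | rule ρ hρ σ hσ =>
    obtain ⟨θ, rfl, hargs⟩ := Expr.HasType.op_inv he
    obtain ⟨Γ, hpat, hrhs⟩ := ρ.typed
    refine hrhs.subst fun x hx => ?_
    obtain ⟨i, hi⟩ := ρ.rhs_vars x hx
    exact (hpat i).of_subst_pattern (ρ.pat_opFree i) (hargs i) hi

/-- Subject reduction. -/
theorem Step.hasType {e e' : Closed S} (h : P.Step e e') {τ : S.Typ}
    (he : Closed.HasType e τ) : Closed.HasType e' τ := by
  induction h generalizing τ with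
  | root h => exact h.hasType he
  | con c es i h ih =>
    obtain ⟨θ, rfl, hargs⟩ := Expr.HasType.con_inv he
    refine Expr.HasType.con c θ _ fun j => ?_
    obtain rfl | hj := eq_or_ne j i
    · rw [Function.update_self]
      exact ih (hargs j)
    · rw [Function.update_of_ne hj]
      exact hargs j
  | op f es i h ih =>
    obtain ⟨θ, rfl, hargs⟩ := Expr.HasType.op_inv he
    refine Expr.HasType.op f θ _ fun j => ?_
    obtain rfl | hj := eq_or_ne j i
    · rw [Function.update_self]
      exact ih (hargs j)
    · rw [Function.update_of_ne hj]
      exact hargs j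

theorem Step.wellTyped {e e' : Closed S} (h : P.Step e e') (he : Closed.WellTyped e) :
    Closed.WellTyped e' :=
  he.imp fun _ hτ => h.hasType hτ

theorem Reduces.hasType {e e' : Closed S} (h : P.Reduces e e') {τ : S.Typ}
    (he : Closed.HasType e τ) : Closed.HasType e' τ := by
  induction h with
  | refl => exact he
  | tail _ h ih => exact h.hasType ih

theorem not_step_of_isValue {e e' : Closed S} (he : e.IsValue) : ¬ P.Step e e' := by
  intro h
  induction h with
  | @root e e' h =>
    cases h
    exact he.elim
  | con c es i _ ih => exact ih (he i)
  | op => exact he.elim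

/-- Steps in the arguments of a symbol have the diamond property if the steps of each argument
have it. -/
theorem diamond_update {n : ℕ} {F : (Fin n → Closed S) → Closed S}
    (hF : ∀ es i e', P.Step (es i) e' → P.Step (F es) (F (Function.update es i e')))
    {es : Fin n → Closed S} {i j : Fin n} {a b : Closed S} (ha : P.Step (es i) a)
    (hb : P.Step (es j) b)
    (hd : ∀ b, P.Step (es i) b → a = b ∨ ∃ c, P.Step a c ∧ P.Step b c) :
    F (Function.update es i a) = F (Function.update es j b) ∨
      ∃ c, P.Step (F (Function.update es i a)) c ∧ P.Step (F (Function.update es j b)) c := by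
  obtain rfl | hij := eq_or_ne i j
  · obtain rfl | ⟨c, hac, hbc⟩ := hd b hb
    · exact Or.inl rfl
    · refine Or.inr ⟨F (Function.update es i c), ?_, ?_⟩
      · simpa using hF (Function.update es i a) i c (by simpa using hac)
      · simpa using hF (Function.update es i b) i c (by simpa using hbc)
  · refine Or.inr ⟨F (Function.update (Function.update es i a) j b), hF _ _ _ ?_, ?_⟩
    · rwa [Function.update_of_ne hij.symm]
    · rw [Function.update_comm hij]
      refine hF _ _ _ ?_
      rwa [Function.update_of_ne hij]

/-- A root step excludes any step inside an argument, so the only cases are two contractions of one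
redex, settled by determinism, and two steps in arguments. -/
theorem Step.diamond (hdet : ∀ f : S.Op, P.DeterministicallyDefined f) {e a b : Closed S}
    (he : Closed.WellTyped e) (ha : P.Step e a) (hb : P.Step e b) :
    a = b ∨ ∃ c, P.Step a c ∧ P.Step b c := by
  obtain ⟨τ, he⟩ := he
  induction ha generalizing b τ with
  | @root e a ha =>
    cases hb with
    | root hb =>
      cases e with
      | var x => exact x.elim
      | con => exact (not_contracts_con ha).elim
      | op f es => exact Or.inl (hdet f es a b ⟨τ, he⟩ ha hb)
    | con => exact (not_contracts_con ha).elim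
    | op f es i hb => exact (not_step_of_isValue (ha.isValue_arg i) hb).elim
  | con c es i ha ih =>
    obtain ⟨θ, rfl, hargs⟩ := Expr.HasType.con_inv he
    cases hb with
    | root hb => exact (not_contracts_con hb).elim
    | con _ _ j hb =>
      exact diamond_update (Step.con c) ha hb fun b hb => ih hb _ (hargs i)
  | op f es i ha ih =>
    obtain ⟨θ, rfl, hargs⟩ := Expr.HasType.op_inv he
    cases hb with
    | root hb => exact (not_step_of_isValue (hb.isValue_arg i) ha).elim
    | op _ _ j hb =>
      exact diamond_update (Step.op f) ha hb fun b hb => ih hb _ (hargs i)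

theorem reduces_update {n : ℕ} {F : (Fin n → Closed S) → Closed S}
    (hF : ∀ es i e', P.Step (es i) e' → P.Step (F es) (F (Function.update es i e')))
    (es : Fin n → Closed S) (i : Fin n) {e' : Closed S} (h : P.Reduces (es i) e') :
    P.Reduces (F es) (F (Function.update es i e')) := by
  induction h with
  | refl =>
    rw [Function.update_eq_self]
    exact .refl
  | @tail a b _ h ih =>
    refine ih.tail ?_
    simpa using hF (Function.update es i a) i b (by simpa using h)

theorem reduces_args {n : ℕ} {F : (Fin n → Closed S) → Closed S}
    (hF : ∀ es i e', P.Step (es i) e' → P.Step (F es) (F (Function.update es i e')))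
    {es vs : Fin n → Closed S} (h : ∀ i, P.Reduces (es i) (vs i)) :
    P.Reduces (F es) (F vs) := by
  -- `s` is the set of argument positions already evaluated.
  have key : ∀ s : Finset (Fin n), P.Reduces (F es) (F (s.piecewise vs es)) := by
    intro s
    induction s using Finset.induction_on with
    | empty =>
      rw [Finset.piecewise_empty]
      exact .refl
    | insert j s hj ih =>
      rw [Finset.piecewise_insert]
      refine ih.trans (reduces_update hF _ j ?_)
      rw [Finset.piecewise_eq_of_notMem s _ _ hj]
      exact h j
  simpa using key Finset.univ

theorem exists_value (htotal : ∀ f : S.Op, P.TotallyDefined f) {e : Closed S} {τ : S.Typ}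
    (he : Closed.HasType e τ) : ∃ v : Closed S, v.IsValue ∧ P.Reduces e v := by
  induction he with
  | var x => exact x.elim
  | con c θ es h ih =>
    choose vs hvs hred using ih
    exact ⟨.con c vs, hvs, reduces_args (Step.con c) hred⟩
  | op f θ es h ih =>
    choose vs hvs hred using ih
    obtain ⟨v, hv, -, hvred⟩ := htotal f θ vs fun i => ⟨hvs i, (hred i).hasType (h i)⟩
    exact ⟨v, hv, (reduces_args (Step.op f) hred).trans hvred⟩

/-- The extra step is pushed along the given reduction by diamonds; it must be absorbed on the way,
since `v` admits no step. -/
theorem Reduces.of_step (hdet : ∀ f : S.Op, P.DeterministicallyDefined f) {e e' v : Closed S}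
    (he : Closed.WellTyped e) (hv : v.IsValue) (h : P.Reduces e v) (hstep : P.Step e e') :
    P.Reduces e' v := by
  induction h using Relation.ReflTransGen.head_induction_on generalizing e' with
  | refl => exact (not_step_of_isValue hv hstep).elim
  | head h₁ h₂ ih =>
    obtain rfl | ⟨c, hc, hc'⟩ := Step.diamond hdet he h₁ hstep
    · exact h₂
    · exact (ih (h₁.wellTyped he) hc).head hc'

theorem Reduces.value_unique (hdet : ∀ f : S.Op, P.DeterministicallyDefined f)
    {e v w : Closed S} (he : Closed.WellTyped e) (hv : v.IsValue) (hw : w.IsValue)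
    (h : P.Reduces e v) (h' : P.Reduces e w) : w = v := by
  induction h' using Relation.ReflTransGen.head_induction_on with
  | refl =>
    obtain rfl | ⟨c, hc, -⟩ := h.cases_head
    · rfl
    · exact (not_step_of_isValue hw hc).elim
  | head h₁ _ ih => exact ih (h₁.wellTyped he) (h.of_step hdet he hv h₁)

/-- An expression with a terminating successor is terminating. -/
theorem acc_of_step (hdet : ∀ f : S.Op, P.DeterministicallyDefined f) {e e' : Closed S}
    (hacc : Acc (flip P.Step) e') (he : Closed.WellTyped e) (h : P.Step e e') :
    Acc (flip P.Step) e := by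
  induction hacc generalizing e with
  | intro e' hacc ih =>
    refine ⟨_, fun a (ha : P.Step e a) => ?_⟩
    obtain rfl | ⟨c, hc, hc'⟩ := Step.diamond hdet he h ha
    · exact ⟨_, hacc⟩
    -- `c` is a successor of `e'`, so the induction hypothesis applies to the step from `a` to `c`.
    · exact ih c hc (ha.wellTyped he) hc'

theorem Reduces.acc (hdet : ∀ f : S.Op, P.DeterministicallyDefined f) {e v : Closed S}
    (he : Closed.WellTyped e) (hv : v.IsValue) (h : P.Reduces e v) : Acc (flip P.Step) e := by
  induction h using Relation.ReflTransGen.head_induction_on with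
  | refl => exact ⟨_, fun a ha => (not_step_of_isValue hv ha).elim⟩
  | head h₁ _ ih => exact acc_of_step hdet (ih (h₁.wellTyped he)) he h₁

theorem not_isInfiniteComputation_of_acc {e : Closed S} (h : Acc (flip P.Step) e)
    (s : ℕ → Closed S) : ¬ P.IsInfiniteComputation e s := by
  induction h generalizing s with
  | intro e _ ih =>
    rintro ⟨rfl, hs⟩
    exact ih (s 1) (hs 0) (fun n => s (n + 1)) ⟨rfl, fun n => hs (n + 1)⟩

end Program

end FLP

theorem mainTheorem6 {S : FLP.Signature} (P : FLP.Program S)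
    (htotal : ∀ f : S.Op, P.TotallyDefined f)
    (hdet : ∀ f : S.Op, P.DeterministicallyDefined f)
    (e : FLP.Closed S) (he : FLP.Closed.WellTyped e) :
    (∃! v : FLP.Closed S, v.IsValue ∧ P.Reduces e v) ∧
      ¬ ∃ s : ℕ → FLP.Closed S, P.IsInfiniteComputation e s := by
  obtain ⟨τ, hτ⟩ := id he
  obtain ⟨v, hv, hred⟩ := FLP.Program.exists_value htotal hτ
  refine ⟨⟨v, ⟨hv, hred⟩, fun w hw => hred.value_unique hdet he hv hw.1 hw.2⟩, ?_⟩
  rintro ⟨s, hs⟩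
  exact FLP.Program.not_isInfiniteComputation_of_acc (hred.acc hdet he hv) s hs
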